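/- Let $H$ be a finite graph with chromatic number $\chi(H)=k+1\ge 3$ that has a critical edge, i.e. an edge $e$ with $\chi(H-e)=\chi(H)-1$. For $n\ge 0$ let $T_k(n)$ be the $k$-partite Turán graph (the complete $k$-partite graph on $n$ vertices with class sizes as equal as possible) and let $t_k(n)$ be its number of edges. Then there is a constant $C$, depending only on $H$, such that for every function $f:\mathbb{N}\to[0,\infty)$ with $f(n)=o(n^2)$ the following hold. (i) There is $n_0$ such that for all $n\ge n_0$, every graph $G$ on $n$ vertices that contains no copy of $H$ as a (not necessarily induced) subgraph and has $e(G)\ge t_k(n)-f(n)$ edges can be formed from $T_k(n)$ by adding and deleting a total of at most $C f(n)^{1/2}n$ edges; that is, on the vertex set of $G$ there is a graph $T\cong T_k(n)$ with $|E(G)\,\triangle\,E(T)|\le C f(n)^{1/2}n$. (ii) There is a constant $C'$, which may depend on $f$ as well as on $H$, such that the same conclusion, with $C'$ in place of $C$, holds for every $n$ with $f(n)>0$. -/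

import Mathlib

open Filter Asymptotics

namespace SimpleGraph

/-- An edge `e` of `H` is critical if `χ(H - e) = χ(H) - 1`
(written additively, to avoid truncated subtraction). -/
def IsCriticalEdge {W : Type*} (H : SimpleGraph W) (e : Sym2 W) : Prop :=
  e ∈ H.edgeSet ∧ (H.deleteEdges {e}).chromaticNumber + 1 = H.chromaticNumber

/-- The graph `H` has a critical edge. -/
def HasCriticalEdge {W : Type*} (H : SimpleGraph W) : Prop :=
  ∃ e : Sym2 W, H.IsCriticalEdge e

/-- The number of edges `t_k(n)` of the `k`-partite Turán graph on `n` vertices. -/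
noncomputable def turanNumber (k n : ℕ) : ℕ :=
  (turanGraph n k).edgeSet.ncard

/-- `G` can be formed from the Turán graph `T_k(n)` by adding and deleting at most `r` edges in
total: some copy `T` of `T_k(n)` on the vertex set of `G` has edge set at symmetric difference at
most `r` from the edge set of `G`. -/
def IsTuranUpTo {n : ℕ} (G : SimpleGraph (Fin n)) (k : ℕ) (r : ℝ) : Prop :=
  ∃ T : SimpleGraph (Fin n), Nonempty (T ≃g turanGraph n k) ∧
    ((symmDiff G.edgeSet T.edgeSet).ncard : ℝ) ≤ r

end SimpleGraph

/-!
The proof bounds the distance to the Turán graph by `O(√r n)` for every graph `G` without `H` on `n`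
vertices that has at least `t_k(n) - r` edges, where `r ≤ δ n ^ 2` and `n` is large
(`exists_isTuranUpTo_sqrt_mul`). Both parts of the theorem follow by taking `r = f n`.

*Large minimum degree forces `k`-colourability.* Deleting its critical edge makes `H` `k`-colourable,
so `H` is contained in every complete `k`-partite graph with large classes and one extra edge inside
a class.
If `G` has minimum degree at least `(1 - 1 / k - ε) n`, the Erdős–Stone theorem gives a complete
`k`-partite subgraph with classes of large constant size. No vertex has many neighbours in all of
these classes, so double counting shows that almost all vertices see most of every class but one.
The vertices with the same exceptional class form an independent set, of size almost `n / k`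
(`Free.exists_isIndepSet_of_isCompleteBetween`). The same two observations, applied to complete
`k`-partite subgraphs chosen greedily inside these independent sets, show that every vertex has
few neighbours in one of the sets, and that colouring it accordingly is proper
(`Free.colorable_of_disjoint_of_isIndepSet`).

*Reduction to large minimum degree.* Put `α = 1 - 1 / k - ε` and let `U` maximize
`2 e(G[U]) - α (m ^ 2 + m)`, where `m = |U|`. Then `G[U]` has minimum degree at least `α m`. Since
each vertex outside `U` accounts for a loss of order `ε n` compared with the Turán graph, `U` is large
and `G[U]` is `k`-colourable. A `k`-partite graph has no more edges than the Turán graph, up to a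
constant, so only `O(r / n)` vertices lie outside `U` (`exists_coloring_of_turanNumber_sub_le`).

*Closeness to the Turán graph.* If `r < 1 / 2`, then no vertex lies outside `U`, and `G` is a Turán
graph by the uniqueness in Turán's theorem; the conclusion is exact when `r = 0`. Otherwise, the
number of edges controls the variance of the sizes of the colour classes, which therefore differ
from `n / k` by `O(√r)`. A permutation of the vertices aligns the classes with those of the
Turán graph `T` up to `O(√r)` vertices, whence `|E(G) \ E(T)| = O(√r n)`; as `G` has at most `r`
fewer edges than `T`, this also bounds `|E(T) \ E(G)|` (`isTuranUpTo_of_coloring`).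
-/

namespace SimpleGraph

open Finset

/-! ### Graphs with a critical edge -/

/-- A graph of chromatic number `k + 1` with a critical edge `xy` has a `k`-colouring whose only
monochromatic edge is `xy`. -/
theorem HasCriticalEdge.exists_almost_coloring {W : Type*} {H : SimpleGraph W} {k : ℕ}
    (hcrit : H.HasCriticalEdge) (hχ : H.chromaticNumber = ((k + 1 : ℕ) : ℕ∞)) :
    ∃ (x y : W) (c : W → Fin k), x ≠ y ∧ c x = c y ∧
      ∀ a b, H.Adj a b → s(a, b) ≠ s(x, y) → c a ≠ c b := by
  obtain ⟨e, he, hec⟩ := hcrit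
  induction e with
  | _ x y =>
  have hcol : (H.deleteEdges {s(x, y)}).Colorable k := by
    rw [← chromaticNumber_le_iff_colorable]
    rw [hχ, Nat.cast_add, Nat.cast_one] at hec
    exact (ENat.add_left_injective_of_ne_top ENat.one_ne_top hec).le
  obtain ⟨c⟩ := hcol
  have hc : ∀ a b, H.Adj a b → s(a, b) ≠ s(x, y) → c a ≠ c b := fun a b hab hne =>
    c.valid (by simpa [deleteEdges_adj, hab] using hne)
  refine ⟨x, y, c, H.ne_of_adj he, ?_, hc⟩
  by_contra hxy
  have hk : H.Colorable k := by
    refine ⟨Coloring.mk c fun {a b} hab => ?_⟩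
    by_cases h : s(a, b) = s(x, y)
    · rcases Sym2.eq_iff.1 h with ⟨rfl, rfl⟩ | ⟨rfl, rfl⟩
      exacts [hxy, Ne.symm hxy]
    · exact hc a b hab h
  have := chromaticNumber_le_iff_colorable.2 hk
  rw [hχ] at this
  have := Nat.cast_le.1 this
  omega

section Embedding

variable {V W : Type*} [Fintype W] {H : SimpleGraph W} {G : SimpleGraph V} {k : ℕ}

/-- A graph with an almost proper `k`-colouring embeds into a complete `k`-partite graph with
large classes to which one edge `uv` inside the class `i` is added. -/
theorem isContained_of_isCompleteBetween_of_adj {x y : W} {c : W → Fin k} (hxy : x ≠ y)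
    (hcxy : c x = c y) (hc : ∀ a b, H.Adj a b → s(a, b) ≠ s(x, y) → c a ≠ c b)
    {S : Fin k → Finset V} (hS : Pairwise fun i j => G.IsCompleteBetween (S i : Set V) (S j))
    (hcard : ∀ i, Fintype.card W ≤ #(S i)) {i : Fin k} {u v : V} (huv : G.Adj u v)
    (hu : ∀ j ≠ i, ∀ b ∈ S j, G.Adj u b) (hv : ∀ j ≠ i, ∀ b ∈ S j, G.Adj v b)
    (hui : u ∉ S i) (hvi : v ∉ S i) : H ⊑ G := by
  classical
  -- a permutation of the colours lets the monochromatic edge have colour `i`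
  wlog hi : c x = i generalizing c
  · refine this (c := Equiv.swap (c x) i ∘ c) (by simp [hcxy])
      (fun a b hab hne => by simpa using hc a b hab hne) (by simp)
  have huS : ∀ j, u ∉ S j := fun j hj => by
    by_cases h : j = i
    · exact hui (h ▸ hj)
    · exact G.irrefl (hu j h u hj)
  have hvS : ∀ j, v ∉ S j := fun j hj => by
    by_cases h : j = i
    · exact hvi (h ▸ hj)
    · exact G.irrefl (hv j h v hj)
  have hf : ∀ j, ∃ f : W ↪ V, ∀ w, f w ∈ S j := fun j => by
    obtain ⟨f⟩ := Function.Embedding.nonempty_of_card_le (α := W) (β := S j)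
      (by simpa using hcard j)
    exact ⟨f.trans (Function.Embedding.subtype _), fun w => (f w).2⟩
  choose f hfS using hf
  let g : W → V := fun w => if w = x then u else if w = y then v else f (c w) w
  have gx : g x = u := by simp [g]
  have gy : g y = v := by simp [g, hxy.symm]
  have gw : ∀ w, w ≠ x → w ≠ y → g w = f (c w) w := fun w h₁ h₂ => by simp [g, h₁, h₂]
  have gS : ∀ w, w ≠ x → w ≠ y → g w ∈ S (c w) := fun w h₁ h₂ => gw w h₁ h₂ ▸ hfS _ _
  have key : ∀ a b, H.Adj a b → G.Adj (g a) (g b) := by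
    -- by symmetry the endpoint of `ab` in `{x, y}`, if any, may be taken to be `a`
    have aux : ∀ a b, H.Adj a b → b ≠ x → b ≠ y → G.Adj (g a) (g b) := by
      intro a b hab hbx hby
      have hcab : c a ≠ c b := hc a b hab fun h => by
        rcases Sym2.eq_iff.1 h with ⟨-, h⟩ | ⟨-, h⟩
        exacts [hby h, hbx h]
      by_cases hax : a = x
      · subst hax
        rw [gx]
        exact hu _ (fun h => hcab (hi.trans h.symm)) _ (gS b hbx hby)
      by_cases hay : a = y
      · subst hay
        rw [gy]
        exact hv _ (fun h => hcab ((hcxy.symm.trans hi).trans h.symm)) _ (gS b hbx hby)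
      exact hS hcab (gS a hax hay) (gS b hbx hby)
    intro a b hab
    by_cases hb : b ≠ x ∧ b ≠ y
    · exact aux a b hab hb.1 hb.2
    by_cases ha : a ≠ x ∧ a ≠ y
    · exact (aux b a hab.symm ha.1 ha.2).symm
    have ha' : a = x ∨ a = y := by tauto
    have hb' : b = x ∨ b = y := by tauto
    rcases ha' with rfl | rfl <;> rcases hb' with rfl | rfl
    · exact (H.irrefl hab).elim
    · rw [gx, gy]; exact huv
    · rw [gx, gy]; exact huv.symm
    · exact (H.irrefl hab).elim
  refine ⟨⟨⟨g, fun {a b} => key a b⟩, ?_⟩⟩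
  intro a b (hab : g a = g b)
  by_cases hax : a = x <;> by_cases hbx : b = x
  · rw [hax, hbx]
  · exfalso
    by_cases hby : b = y
    · rw [hax, hby, gx, gy] at hab
      exact huv.ne hab
    · exact huS _ (by rw [← gx, ← hax, hab]; exact gS b hbx hby)
  · exfalso
    by_cases hay : a = y
    · rw [hay, hbx, gx, gy] at hab
      exact huv.ne hab.symm
    · exact huS _ (by rw [← gx, ← hbx, ← hab]; exact gS a hax hay)
  · by_cases hay : a = y <;> by_cases hby : b = y
    · rw [hay, hby]
    · exact (hvS _ (by rw [← gy, ← hay, hab]; exact gS b hbx hby)).elim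
    · exact (hvS _ (by rw [← gy, ← hby, ← hab]; exact gS a hax hay)).elim
    · have h₁ := gS a hax hay
      have h₂ := gS b hbx hby
      have hcab : c a = c b := by
        by_contra hne
        exact (hS hne h₁ h₂).ne hab
      rw [gw a hax hay, gw b hbx hby, hcab] at hab
      exact (f (c b)).injective hab

open scoped Classical in
/-- In a graph without `H`, two vertices with many common neighbours in all classes but one of a
complete `k`-partite subgraph are not adjacent. -/
theorem Free.not_adj_of_isCompleteBetween (hG : H.Free G) (hcrit : H.HasCriticalEdge)
    (hχ : H.chromaticNumber = ((k + 1 : ℕ) : ℕ∞)) {S : Fin k → Finset V}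
    (hS : Pairwise fun i j => G.IsCompleteBetween (S i : Set V) (S j)) (i : Fin k)
    (hi : Fintype.card W + 2 ≤ #(S i)) (u v : V)
    (huv : ∀ j ≠ i, Fintype.card W ≤ #{b ∈ S j | G.Adj u b ∧ G.Adj v b}) : ¬ G.Adj u v := by
  intro hadj
  obtain ⟨x, y, c, hxy, hcxy, hc⟩ := hcrit.exists_almost_coloring hχ
  let S' : Fin k → Finset V := fun j =>
    if j = i then (S i \ {u, v}) else {b ∈ S j | G.Adj u b ∧ G.Adj v b}
  have hsub : ∀ j, S' j ⊆ S j := fun j => by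
    by_cases h : j = i
    · subst h; simp only [S', if_true]; exact sdiff_subset
    · simp [S', h]
  refine hG (isContained_of_isCompleteBetween_of_adj (S := S') (i := i) (u := u) (v := v)
    hxy hcxy hc ?_ ?_ hadj ?_ ?_ ?_ ?_)
  · exact fun a b hab p hp q hq => hS hab (hsub a hp) (hsub b hq)
  · intro j
    by_cases h : j = i
    · subst h
      have h1 := le_card_sdiff {u, v} (S j)
      have h2 := card_le_two (a := u) (b := v)
      simp only [S', if_true]
      omega
    · simpa [S', h] using huv j h
  · intro j hj b hb
    simp only [S', hj, if_false, mem_filter] at hb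
    exact hb.2.1
  · intro j hj b hb
    simp only [S', hj, if_false, mem_filter] at hb
    exact hb.2.2
  · simp [S']
  · simp [S']

open scoped Classical in
/-- In a graph without `H`, every vertex has few neighbours in some class of a complete
`k`-partite subgraph. -/
theorem Free.exists_card_filter_adj_lt (hG : H.Free G) (hcrit : H.HasCriticalEdge)
    (hχ : H.chromaticNumber = ((k + 1 : ℕ) : ℕ∞)) (hk : 0 < k) {S : Fin k → Finset V}
    (hS : Pairwise fun i j => G.IsCompleteBetween (S i : Set V) (S j)) (v : V) :
    ∃ i, #{b ∈ S i | G.Adj v b} < Fintype.card W + 2 := by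
  by_contra! h
  let i : Fin k := ⟨0, hk⟩
  have hpos : 0 < #{b ∈ S i | G.Adj v b} := by have := h i; omega
  obtain ⟨u, hu⟩ := card_pos.1 hpos
  rw [mem_filter] at hu
  refine hG.not_adj_of_isCompleteBetween hcrit hχ hS i
    ((h i).trans (card_filter_le _ _)) v u (fun j hj => ?_) hu.2
  have : {b ∈ S j | G.Adj v b ∧ G.Adj u b} = {b ∈ S j | G.Adj v b} :=
    filter_congr fun b hb => and_iff_left (hS hj.symm hu.1 hb)
  rw [this]
  have := h j
  omega

end Embedding

open scoped Classical in
/-- Greedy choice of a complete `k`-partite subgraph with classes of size `q` inside prescribed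
sets `X i`, when every vertex of these sets has few non-neighbours in the other sets. -/
theorem exists_isCompleteBetween_of_card_not_adj_le {V : Type*} {G : SimpleGraph V} {k : ℕ}
    (X : Fin k → Finset V) (q : ℕ) {μ : ℝ} (hμ : 0 ≤ μ)
    (hmiss : ∀ i j, i ≠ j → ∀ a ∈ X i, (#{b ∈ X j | ¬ G.Adj a b} : ℝ) ≤ μ)
    (hX : ∀ j, k * q * μ + q ≤ #(X j)) :
    ∃ S : Fin k → Finset V, (∀ i, S i ⊆ X i ∧ #(S i) = q) ∧
      Pairwise fun i j => G.IsCompleteBetween (S i : Set V) (S j) := by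
  suffices h : ∀ J : Finset (Fin k), ∃ S : Fin k → Finset V,
      (∀ i ∈ J, S i ⊆ X i ∧ #(S i) = q) ∧ ∀ i ∈ J, ∀ j ∈ J, i ≠ j →
        G.IsCompleteBetween (S i : Set V) (S j) by
    obtain ⟨S, h₁, h₂⟩ := h univ
    exact ⟨S, fun i => h₁ i (mem_univ i), fun i j hij => h₂ i (mem_univ i) j (mem_univ j) hij⟩
  intro J
  induction J using Finset.induction_on with
  | empty => exact ⟨fun _ => ∅, by simp, by simp⟩
  | insert l J hl ih =>
    obtain ⟨S, hS, hSc⟩ := ih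
    let B : Finset V := J.biUnion fun i => (S i).biUnion fun a => {b ∈ X l | ¬ G.Adj a b}
    have hB : (#B : ℝ) ≤ k * q * μ := by
      calc (#B : ℝ) ≤ ∑ i ∈ J, ∑ a ∈ S i, (#{b ∈ X l | ¬ G.Adj a b} : ℝ) := by
            have h : #B ≤ ∑ i ∈ J, ∑ a ∈ S i, #{b ∈ X l | ¬ G.Adj a b} :=
              card_biUnion_le.trans (sum_le_sum fun i _ => card_biUnion_le)
            exact_mod_cast h
        _ ≤ ∑ i ∈ J, ∑ a ∈ S i, μ := by
            refine sum_le_sum fun i hi => sum_le_sum fun a ha => ?_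
            exact hmiss i l (fun h => hl (h ▸ hi)) a ((hS i hi).1 ha)
        _ = ∑ i ∈ J, q * μ := sum_congr rfl fun i hi => by
            rw [sum_const, (hS i hi).2, nsmul_eq_mul]
        _ = #J * (q * μ) := by rw [sum_const, nsmul_eq_mul]
        _ ≤ k * (q * μ) := by
            have : #J ≤ k := by simpa using card_le_univ J
            gcongr
        _ = k * q * μ := by ring
    have hq : q ≤ #(X l \ B) := by
      have h1 : #(X l) ≤ #(X l \ B) + #B := by
        have := le_card_sdiff B (X l)
        omega
      have h2 := hX l
      have h3 : (#(X l) : ℝ) ≤ #(X l \ B) + #B := by exact_mod_cast h1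
      have : (q : ℝ) ≤ #(X l \ B) := by linarith
      exact_mod_cast this
    obtain ⟨A, hAsub, hA⟩ := exists_subset_card_eq hq
    have hAdj : ∀ i ∈ J, ∀ a ∈ S i, ∀ b ∈ A, G.Adj a b := by
      intro i hi a ha b hb
      by_contra hab
      have hb' := mem_sdiff.1 (hAsub hb)
      exact hb'.2 (mem_biUnion.2 ⟨i, hi, mem_biUnion.2 ⟨a, ha, mem_filter.2 ⟨hb'.1, hab⟩⟩⟩)
    have hne : ∀ i ∈ J, i ≠ l := fun i hi h => hl (h ▸ hi)
    refine ⟨Function.update S l A, ?_, ?_⟩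
    · intro i hi
      rcases mem_insert.1 hi with rfl | hi
      · simpa [hA] using hAsub.trans sdiff_subset
      · simpa [hne i hi] using hS i hi
    · intro i hi j hj hij
      rcases mem_insert.1 hi with rfl | hi' <;> rcases mem_insert.1 hj with rfl | hj'
      · exact (hij rfl).elim
      · rw [Function.update_self, Function.update_of_ne hij.symm]
        exact fun a ha b hb => (hAdj j hj' b hb a ha).symm
      · rw [Function.update_self, Function.update_of_ne hij]
        exact fun a ha b hb => hAdj i hi' a ha b hb
      · rw [Function.update_of_ne (hne i hi'), Function.update_of_ne (hne j hj')]
        exact hSc i hi' j hj' hij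

/-! ### Graphs of large minimum degree without `H` are `k`-colourable -/

section MinDegree

variable {V W : Type*} [Fintype V] [Fintype W] {H : SimpleGraph W} {G : SimpleGraph V} {k : ℕ}

open scoped Classical in
/-- Splitting the vertices outside `A` into neighbours and non-neighbours of `v`. -/
theorem card_filter_adj_add_card_not_adj (G : SimpleGraph V) (A : Finset V) (v : V) :
    #{x | x ∉ A ∧ ¬ G.Adj v x} + #{x | G.Adj v x} + #A =
      Fintype.card V + #{x ∈ A | G.Adj v x} := by
  have h1 := card_filter_add_card_filter_not (s := (univ : Finset V)) (fun x => x ∈ A)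
  have h2 := card_filter_add_card_filter_not (s := A) (fun x => G.Adj v x)
  have h3 := card_filter_add_card_filter_not (s := ({x | x ∉ A} : Finset V)) (fun x => G.Adj v x)
  have h4 := card_filter_add_card_filter_not (s := ({x | G.Adj v x} : Finset V)) (fun x => x ∈ A)
  simp only [filter_filter, filter_univ_mem, card_univ] at h1 h2 h3 h4
  have h5 : #{x | G.Adj v x ∧ x ∈ A} = #{x ∈ A | G.Adj v x} := by
    congr 1; ext; simp [and_comm]
  have h6 : #{x | G.Adj v x ∧ x ∉ A} = #{x | x ∉ A ∧ G.Adj v x} := by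
    congr 1; ext; simp [and_comm]
  omega

open scoped Classical in
/-- If `A` contains few neighbours of `v` and is not much smaller than `n / k`, and `v` has degree
almost `(1 - 1 / k) n`, then `v` is adjacent to almost all vertices outside `A`. -/
theorem card_not_adj_le_of_le_degree {A : Finset V} {v : V} {n ε μ η : ℝ}
    (hn : n = Fintype.card V) (hA : (1 / k - μ) * n ≤ #A)
    (hdeg : (1 - 1 / k - ε) * n ≤ (#{x | G.Adj v x} : ℝ))
    (hvA : (#{x ∈ A | G.Adj v x} : ℝ) ≤ η * n) {B : Finset V} (hB : Disjoint B A) :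
    (#{x ∈ B | ¬ G.Adj v x} : ℝ) ≤ (μ + ε + η) * n := by
  have h1 : #{x ∈ B | ¬ G.Adj v x} ≤ #{x | x ∉ A ∧ ¬ G.Adj v x} := by
    refine card_le_card fun x hx => ?_
    rw [mem_filter] at hx ⊢
    exact ⟨mem_univ _, Finset.disjoint_left.1 hB hx.1, hx.2⟩
  have h2 := G.card_filter_adj_add_card_not_adj A v
  have h1' : (#{x ∈ B | ¬ G.Adj v x} : ℝ) ≤ #{x | x ∉ A ∧ ¬ G.Adj v x} := by exact_mod_cast h1
  have h2' : (#{x | x ∉ A ∧ ¬ G.Adj v x} : ℝ) + #{x | G.Adj v x} + #A =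
    n + #{x ∈ A | G.Adj v x} := by rw [hn]; exact_mod_cast h2
  nlinarith

open scoped Classical in
/-- Suppose that `G` contains no copy of `H`, has minimum degree almost `(1 - 1 / k) n`, and has
disjoint independent sets `P i` of size almost `n / k`. Giving every vertex `v` a colour `i` such
that `v` has few neighbours in `P i` is a proper `k`-colouring. -/
theorem Free.colorable_of_disjoint_of_isIndepSet (hG : H.Free G) (hcrit : H.HasCriticalEdge)
    (hχ : H.chromaticNumber = ((k + 1 : ℕ) : ℕ∞)) (hk : 0 < k) {n q ε μ : ℝ}
    (hn : n = Fintype.card V) (hq : q = Fintype.card W + 2) (hε : ε ≤ μ) (hμ : 0 < μ)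
    (hμk : μ * (5 + 12 * k * q) ≤ 1 / k) (hnμ : 1 ≤ k * μ * n)
    (hdeg : ∀ v, (1 - 1 / k - ε) * n ≤ (#{x | G.Adj v x} : ℝ))
    {P : Fin k → Finset V} (hdisj : Pairwise fun i j => Disjoint (P i) (P j))
    (hP : ∀ i, (1 / k - μ) * n ≤ #(P i)) (hind : ∀ i, ∀ u ∈ P i, ∀ v ∈ P i, ¬ G.Adj u v) :
    G.Colorable k := by
  have hq0 : 2 ≤ q := by rw [hq]; linarith [Nat.cast_nonneg (α := ℝ) (Fintype.card W)]
  have hn0 : 0 ≤ n := by rw [hn]; positivity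
  have hk1 : (1 : ℝ) ≤ k := by exact_mod_cast hk
  have hqcast : ((Fintype.card W + 2 : ℕ) : ℝ) = q := by rw [hq]; push_cast; rfl
  -- `η n` bounds the number of neighbours of a vertex in the class with its own colour
  set η : ℝ := 2 * k * q * μ with hη
  have hηn : k * q * (2 * μ * n) = η * n := by rw [hη]; ring
  have hηq : k * q * (2 * μ * n) + q ≤ 2 * η * n := by
    have : q * 1 ≤ q * (k * μ * n) := by gcongr
    nlinarith [mul_nonneg hn0 (show 0 ≤ η by positivity)]
  have hmissP : ∀ i j, i ≠ j → ∀ a ∈ P i, (#{b ∈ P j | ¬ G.Adj a b} : ℝ) ≤ 2 * μ * n := by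
    intro i j hij a ha
    have h0 : {x ∈ P i | G.Adj a x} = ∅ := filter_eq_empty_iff.2 fun x hx => hind i a ha x hx
    have h := card_not_adj_le_of_le_degree (η := 0) hn (hP i) (hdeg a) (by simp [h0])
      (hdisj hij.symm)
    refine h.trans ?_
    have : (μ + ε + 0) ≤ 2 * μ := by linarith
    gcongr
  have hex : ∀ v, ∃ i, (#{x ∈ P i | G.Adj v x} : ℝ) < 2 * η * n := by
    intro v
    by_contra! h
    obtain ⟨S, hS, hSc⟩ := exists_isCompleteBetween_of_card_not_adj_le
      (G := G) (fun i => {x ∈ P i | G.Adj v x}) (Fintype.card W + 2) (μ := 2 * μ * n)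
      (by positivity) (fun i j hij a ha => (Nat.cast_le.2 (card_le_card (filter_subset_filter _
        (filter_subset _ _)))).trans (hmissP i j hij a (mem_filter.1 ha).1))
      (fun j => by rw [hqcast]; exact hηq.trans (h j))
    obtain ⟨i, hi⟩ := hG.exists_card_filter_adj_lt hcrit hχ hk hSc v
    have : {b ∈ S i | G.Adj v b} = S i :=
      filter_true_of_mem fun b hb => (mem_filter.1 ((hS i).1 hb)).2
    rw [this, (hS i).2] at hi
    exact hi.false
  choose c hc using hex
  refine ⟨Coloring.mk c fun {u v} huv hcuv => ?_⟩
  have hmiss : ∀ w, ∀ j ≠ c w, (#{b ∈ P j | ¬ G.Adj w b} : ℝ) ≤ (2 * μ + 2 * η) * n := by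
    intro w j hj
    have h := card_not_adj_le_of_le_degree hn (hP (c w)) (hdeg w) (hc w).le (hdisj hj)
    refine h.trans ?_
    have : μ + ε + 2 * η ≤ 2 * μ + 2 * η := by linarith
    gcongr
  let X : Fin k → Finset V := fun j =>
    if j = c u then P j else {b ∈ P j | G.Adj u b ∧ G.Adj v b}
  have hXP : ∀ j, X j ⊆ P j := fun j => by
    by_cases h : j = c u
    · simp [X, h]
    · simp [X, h]
  have hXcard : ∀ j, k * (Fintype.card W + 2 : ℕ) * (2 * μ * n) + (Fintype.card W + 2 : ℕ) ≤
      (#(X j) : ℝ) := by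
    intro j
    rw [hqcast]
    refine hηq.trans ?_
    have hbig : (5 * μ + 6 * η) * n ≤ 1 / k * n := by
      refine mul_le_mul_of_nonneg_right ?_ hn0
      rw [hη]; linarith
    by_cases h : j = c u
    · have := hP j
      simp only [X, h, if_true] at this ⊢
      nlinarith [mul_nonneg hn0 hμ.le, mul_nonneg hn0 (show 0 ≤ η by positivity)]
    · have h1 := hmiss u j h
      have h2 := hmiss v j (hcuv ▸ h)
      have h3 : #(P j) ≤ #{b ∈ P j | G.Adj u b ∧ G.Adj v b} + #{b ∈ P j | ¬ G.Adj u b} +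
          #{b ∈ P j | ¬ G.Adj v b} := by
        refine (card_le_card fun b hb => ?_).trans ((card_union_le _ _).trans
          (Nat.add_le_add_right (card_union_le _ _) _))
        simp only [mem_union, mem_filter, hb, true_and]
        tauto
      have h3' : (#(P j) : ℝ) ≤ #{b ∈ P j | G.Adj u b ∧ G.Adj v b} + #{b ∈ P j | ¬ G.Adj u b} +
          #{b ∈ P j | ¬ G.Adj v b} := by exact_mod_cast h3
      have := hP j
      simp only [X, h, if_false]
      linarith
  obtain ⟨S, hS, hSc⟩ := exists_isCompleteBetween_of_card_not_adj_le
      (G := G) X (Fintype.card W + 2) (μ := 2 * μ * n)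
      (by positivity) (fun i j hij a ha => (Nat.cast_le.2 (card_le_card (filter_subset_filter _
        (hXP j)))).trans (hmissP i j hij a (hXP i ha))) hXcard
  refine hG.not_adj_of_isCompleteBetween hcrit hχ hSc (c u) (hS _).2.ge u v (fun j hj => ?_) huv
  have : {b ∈ S j | G.Adj u b ∧ G.Adj v b} = S j := filter_true_of_mem fun b hb => by
    have := (hS j).1 hb
    simp only [X, hj, if_false, mem_filter] at this
    exact this.2
  rw [this, (hS j).2]
  omega

end MinDegree

section ErdosStone

open scoped Classical in
/-- The minimum degree form of the Erdős–Stone theorem on an arbitrary finite vertex type; the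
classes of the complete multipartite subgraph are given as a family of sets. -/
theorem exists_isCompleteBetween_of_le_degree {ε : ℝ} (hε : 0 < ε) (r t : ℕ) :
    ∃ N : ℕ, ∀ {V : Type*} [Fintype V] (G : SimpleGraph V), N ≤ Fintype.card V →
      (∀ v, (1 - 1 / r + ε) * Fintype.card V ≤ (#{x | G.Adj v x} : ℝ)) →
      ∃ S : Fin (r + 1) → Finset V, (∀ i, #(S i) = t) ∧
        Pairwise fun i j => G.IsCompleteBetween (S i : Set V) (S j) := by
  obtain ⟨N, hN⟩ := eventually_atTop.1
    (eventually_completeEquipartiteGraph_isContained_of_minDegree hε r t)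
  refine ⟨max N 1, fun {V} _ G hV hdeg => ?_⟩
  have hV1 : 1 ≤ Fintype.card V := (le_max_right _ _).trans hV
  have : Nonempty V := Fintype.card_pos_iff.1 hV1
  have hiso := G.overFinIso (rfl : Fintype.card V = Fintype.card V)
  have hmin : (1 - 1 / r + ε) * Fintype.card V ≤ (G.minDegree : ℝ) := by
    obtain ⟨v, hv⟩ := G.exists_minimal_degree_vertex
    rw [hv, ← card_neighborFinset_eq_degree, neighborFinset_eq_filter]
    convert hdeg v
  rw [hiso.minDegree_eq] at hmin
  have hcont := hN _ ((le_max_left _ _).trans hV) hmin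
  rw [← isContained_congr_right hiso] at hcont
  obtain ⟨f⟩ := hcont
  refine ⟨fun i => univ.image fun a : Fin t => f (i, a), fun i => ?_, fun i j hij => ?_⟩
  · rw [card_image_of_injective, card_univ, Fintype.card_fin]
    intro a b hab
    simpa using f.injective hab
  · intro a ha b hb
    simp only [coe_image, coe_univ, Set.image_univ, Set.mem_range] at ha hb
    obtain ⟨a, rfl⟩ := ha
    obtain ⟨b, rfl⟩ := hb
    exact f.toHom.map_adj (by simpa [completeEquipartiteGraph_adj] using hij)

end ErdosStone

section Partition

variable {V W : Type*} [Fintype V] [Fintype W] {H : SimpleGraph W} {G : SimpleGraph V} {k : ℕ}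

open scoped Classical in
/-- Disjoint independent sets covering almost all vertices of a graph of minimum degree almost
`(1 - 1 / k) n` have size almost `n / k`. -/
theorem le_card_of_isIndepSet {n ε β : ℝ} (hn : n = Fintype.card V) (hk : 1 < k) (hε : 0 ≤ ε)
    (hdeg : ∀ v, (1 - 1 / k - ε) * n ≤ (#{x | G.Adj v x} : ℝ)) {P : Fin k → Finset V}
    (hind : ∀ i, ∀ u ∈ P i, ∀ v ∈ P i, ¬ G.Adj u v) (hcov : (1 - β) * n ≤ ∑ i, (#(P i) : ℝ))
    (i : Fin k) : (1 / k - (β + k * ε)) * n ≤ #(P i) := by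
  have hn0 : 0 ≤ n := by rw [hn]; positivity
  have hk0 : (0 : ℝ) < k := by exact_mod_cast (zero_lt_one.trans hk)
  have hup : ∀ j, (#(P j) : ℝ) ≤ (1 / k + ε) * n := by
    intro j
    rcases (P j).eq_empty_or_nonempty with h | ⟨v, hv⟩
    · rw [h, card_empty, Nat.cast_zero]; positivity
    · have h1 := G.card_filter_adj_add_card_not_adj (P j) v
      have h0 : #{x ∈ P j | G.Adj v x} = 0 :=
        card_eq_zero.2 (filter_eq_empty_iff.2 fun x hx => hind j v hv x hx)
      have h2 : (#{x | G.Adj v x} : ℝ) + #(P j) ≤ n := by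
        rw [hn]; exact_mod_cast (by omega : #{x | G.Adj v x} + #(P j) ≤ Fintype.card V)
      have := hdeg v
      linarith
  have hsum : ∑ j, (#(P j) : ℝ) ≤ #(P i) + (k - 1) * ((1 / k + ε) * n) := by
    rw [← add_sum_erase _ _ (mem_univ i)]
    gcongr
    refine (sum_le_sum fun j _ => hup j).trans_eq ?_
    rw [sum_const, card_erase_of_mem (mem_univ i), card_univ, Fintype.card_fin, nsmul_eq_mul,
      Nat.cast_sub hk.le, Nat.cast_one]
  have : ((k : ℝ) - 1) * ((1 / k + ε) * n) = (1 - 1 / k + k * ε - ε) * n := by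
    field_simp
    ring
  nlinarith [mul_nonneg hε hn0]

open scoped Classical in
/-- From a complete `k`-partite subgraph with classes `S i` of constant size `t`, a graph without
`H` of minimum degree almost `(1 - 1 / k) n` inherits disjoint independent sets that cover almost
all vertices: the `i`-th one consists of the vertices that are adjacent to most of every class
except `S i`. -/
theorem Free.exists_isIndepSet_of_isCompleteBetween (hG : H.Free G) (hcrit : H.HasCriticalEdge)
    (hχ : H.chromaticNumber = ((k + 1 : ℕ) : ℕ∞)) (hk : 1 < k) {n ε q : ℝ} {t : ℕ}
    (hn : n = Fintype.card V) (hq : q = Fintype.card W + 2) (hkε : k * ε ≤ 1 / 2)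
    (ht : q ≤ k * ε * t) (ht0 : 0 < t)
    (hdeg : ∀ v, (1 - 1 / k - ε) * n ≤ (#{x | G.Adj v x} : ℝ))
    {S : Fin k → Finset V} (hS : ∀ i, #(S i) = t)
    (hSc : Pairwise fun i j => G.IsCompleteBetween (S i : Set V) (S j)) :
    ∃ P : Fin k → Finset V, (Pairwise fun i j => Disjoint (P i) (P j)) ∧
      (∀ i, ∀ u ∈ P i, ∀ v ∈ P i, ¬ G.Adj u v) ∧ (1 - 8 * k * ε) * n ≤ ∑ i, (#(P i) : ℝ) := by
  have ht' : (0 : ℝ) < t := by exact_mod_cast ht0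
  have hk0 : (0 : ℝ) < k := by exact_mod_cast (zero_lt_one.trans hk)
  have htq : q ≤ 1 / 2 * t := ht.trans (by gcongr)
  let d : V → Fin k → ℕ := fun v i => #{b ∈ S i | G.Adj v b}
  have hd : ∀ v i, (d v i : ℝ) ≤ t := fun v i => by
    exact_mod_cast (card_filter_le _ _).trans (hS i).le
  have hex : ∀ v, ∃ i, (d v i : ℝ) < q := fun v => by
    obtain ⟨i, hi⟩ := hG.exists_card_filter_adj_lt hcrit hχ (zero_lt_one.trans hk) hSc v
    exact ⟨i, by rw [hq]; exact_mod_cast hi⟩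
  choose c hc using hex
  let A : Finset V := {v | ∀ j ≠ c v, 3 / 4 * (t : ℝ) ≤ d v j}
  refine ⟨fun i => {v ∈ A | c v = i}, fun i j hij => ?_, fun i u hu v hv => ?_, ?_⟩
  · refine Finset.disjoint_left.2 fun v hv hv' => hij ?_
    rw [← (mem_filter.1 hv).2, ← (mem_filter.1 hv').2]
  · simp only [A, mem_filter, mem_univ, true_and] at hu hv
    obtain ⟨hu, rfl⟩ := hu
    obtain ⟨hv, hcv⟩ := hv
    refine hG.not_adj_of_isCompleteBetween hcrit hχ hSc (c u) ?_ u v fun j hj => ?_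
    · rw [hS]
      have : ((Fintype.card W + 2 : ℕ) : ℝ) ≤ t := by push_cast; linarith
      exact_mod_cast this
    · have h1 := hu j hj
      have h2 := hv j (hcv ▸ hj)
      have h3 : d u j + d v j ≤ #{b ∈ S j | G.Adj u b ∧ G.Adj v b} + t := by
        simp only [d]
        rw [← card_union_add_card_inter, ← filter_and, add_comm, ← hS j]
        gcongr
        rw [← filter_or]
        exact filter_subset _ _
      have h3' : (d u j : ℝ) + d v j ≤ #{b ∈ S j | G.Adj u b ∧ G.Adj v b} + t := by
        exact_mod_cast h3
      have : (Fintype.card W : ℝ) ≤ #{b ∈ S j | G.Adj u b ∧ G.Adj v b} := by linarith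
      exact_mod_cast this
  · have hsumA : ∑ i, (#{v ∈ A | c v = i} : ℝ) = #A := by
      rw [card_eq_sum_card_fiberwise (f := c) (t := univ) (fun _ _ => by simp)]
      push_cast
      rfl
    -- double counting of the edges between the vertices of `S` and all vertices
    have hlow : k * (t * ((1 - 1 / k - ε) * n)) ≤ ∑ v, ∑ i, (d v i : ℝ) := by
      have hcount : ∑ v, ∑ i, d v i = ∑ i, ∑ b ∈ S i, #{x | G.Adj b x} := by
        rw [sum_comm]
        refine sum_congr rfl fun i _ => ?_
        simp only [d, card_filter]
        rw [sum_comm]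
        simp only [G.adj_comm]
      have hcount' : ∑ v, ∑ i, (d v i : ℝ) = ∑ i, ∑ b ∈ S i, (#{x | G.Adj b x} : ℝ) := by
        exact_mod_cast hcount
      rw [hcount']
      calc k * (t * ((1 - 1 / k - ε) * n)) = ∑ i : Fin k, ∑ b ∈ S i, (1 - 1 / k - ε) * n := by
            simp [hS]
        _ ≤ _ := sum_le_sum fun i _ => sum_le_sum fun b _ => hdeg b
    have hup : ∀ v, ∑ i, (d v i : ℝ) ≤ ((k - 1) * t + q) - if v ∈ A then 0 else (t / 4 : ℝ) := by
      intro v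
      rw [← add_sum_erase _ _ (mem_univ (c v))]
      split_ifs with hv
      · have : ∑ i ∈ univ.erase (c v), (d v i : ℝ) ≤ ∑ i ∈ univ.erase (c v), (t : ℝ) :=
          sum_le_sum fun i _ => hd v i
        rw [sum_const, card_erase_of_mem (mem_univ _), card_univ, Fintype.card_fin, nsmul_eq_mul,
          Nat.cast_sub hk.le, Nat.cast_one] at this
        linarith [hc v]
      · simp only [A, mem_filter, mem_univ, true_and, not_forall, not_le] at hv
        obtain ⟨j, hj, hlt⟩ := hv
        have hj' : j ∈ univ.erase (c v) := mem_erase.2 ⟨hj, mem_univ _⟩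
        rw [← add_sum_erase _ _ hj']
        have : ∑ i ∈ (univ.erase (c v)).erase j, (d v i : ℝ) ≤
            ∑ i ∈ (univ.erase (c v)).erase j, (t : ℝ) := sum_le_sum fun i _ => hd v i
        rw [sum_const, card_erase_of_mem hj', card_erase_of_mem (mem_univ _), card_univ,
          Fintype.card_fin, nsmul_eq_mul, Nat.sub_sub, Nat.cast_sub hk] at this
        push_cast at this
        linarith [hc v]
    have hupsum : ∑ v, ∑ i, (d v i : ℝ) ≤ n * ((k - 1) * t + q) - (n - #A) * (t / 4) := by
      refine (sum_le_sum fun v _ => hup v).trans_eq ?_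
      rw [sum_sub_distrib, sum_const, card_univ, nsmul_eq_mul, ← hn]
      congr 1
      have : ∀ v, (if v ∈ A then 0 else (t / 4 : ℝ)) = t / 4 - if v ∈ A then (t / 4 : ℝ) else 0 :=
        fun v => by split_ifs <;> ring
      simp only [this]
      rw [sum_sub_distrib, sum_const, card_univ, nsmul_eq_mul, ← hn, ← sum_filter, sum_const,
        filter_univ_mem, nsmul_eq_mul]
      ring
    have hn0 : 0 ≤ n := by rw [hn]; positivity
    have hexp : k * (t * ((1 - 1 / k - ε) * n)) = n * ((k - 1) * t) - k * ε * t * n := by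
      field_simp
    have hqn : n * q ≤ n * (k * ε * t) := by gcongr
    have hfin : (n - #A) * t ≤ (8 * k * ε * n) * t := by nlinarith
    have := le_of_mul_le_mul_right hfin ht'
    simp only [hsumA]
    linarith

end Partition

open scoped Classical in
/-- A sufficiently large graph without `H` whose minimum degree is almost `(1 - 1 / k) n` is
`k`-colourable, if `H` has chromatic number `k + 1` and a critical edge. -/
theorem exists_colorable_of_le_degree {W : Type*} [Fintype W] {H : SimpleGraph W} {k : ℕ}
    (hk : 2 ≤ k) (hcrit : H.HasCriticalEdge) (hχ : H.chromaticNumber = ((k + 1 : ℕ) : ℕ∞)) :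
    ∃ ε : ℝ, 0 < ε ∧ ε ≤ 1 / 4 ∧ ∃ N : ℕ, ∀ {V : Type*} [Fintype V] (G : SimpleGraph V),
      N ≤ Fintype.card V → H.Free G →
      (∀ v, (1 - 1 / k - ε) * Fintype.card V ≤ (#{x | G.Adj v x} : ℝ)) → G.Colorable k := by
  obtain ⟨r, rfl⟩ : ∃ r, k = r + 1 := ⟨k - 1, by omega⟩
  set k := r + 1 with hkr
  have hr : (1 : ℝ) ≤ r := by exact_mod_cast (by omega : 1 ≤ r)
  have hk2 : (2 : ℝ) ≤ k := by exact_mod_cast hk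
  obtain ⟨q, hq⟩ : ∃ q : ℝ, q = Fintype.card W + 2 := ⟨_, rfl⟩
  have hq2 : 2 ≤ q := by rw [hq]; linarith [Nat.cast_nonneg (α := ℝ) (Fintype.card W)]
  set μ : ℝ := 1 / (k * (5 + 12 * k * q)) with hμ
  have hμ0 : 0 < μ := by positivity
  set ε : ℝ := μ / (9 * k) with hε
  have hε0 : 0 < ε := by positivity
  have hμε : μ = 9 * k * ε := by rw [hε]; field_simp
  have hμk : μ * (5 + 12 * k * q) = 1 / k := by rw [hμ]; field_simp
  have hkinv : (1 : ℝ) / k ≤ 1 / 2 := one_div_le_one_div_of_le (by norm_num) hk2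
  have hμsmall : 53 * μ ≤ 1 / k := by
    rw [← hμk, mul_comm]
    gcongr
    nlinarith
  have hεμ : 18 * ε ≤ μ := by rw [hμε]; nlinarith
  obtain ⟨t, ht⟩ := exists_nat_ge (max 1 (q / (k * ε)))
  have ht1 : (1 : ℝ) ≤ t := (le_max_left _ _).trans ht
  have htq : q ≤ k * ε * t := by
    have := (le_max_right _ _).trans ht
    rwa [div_le_iff₀' (by positivity)] at this
  obtain ⟨N, hN⟩ := exists_isCompleteBetween_of_le_degree hε0 r t
  obtain ⟨N', hN'⟩ := exists_nat_ge (1 / (k * μ))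
  refine ⟨ε, hε0, by linarith, max N N', fun {V} _ G hV hG hdeg => ?_⟩
  have hgap : (1 - 1 / r + ε : ℝ) ≤ 1 - 1 / k - ε := by
    have h1 : (1 : ℝ) / r - 1 / k = 1 / r * (1 / k) := by
      rw [hkr]; push_cast; field_simp; ring
    have h2 : 2 * ε ≤ 1 / r * (1 / k) := by
      have h3 : 2 * ε * k ≤ 1 / k := by nlinarith
      have h4 : (1 : ℝ) / k ≤ 1 / r := one_div_le_one_div_of_le (by linarith)
        (by rw [hkr]; push_cast; linarith)
      rw [mul_one_div, le_div_iff₀ (by positivity)]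
      linarith
    linarith
  obtain ⟨S, hS, hSc⟩ := hN G ((le_max_left _ _).trans hV) fun v =>
    (mul_le_mul_of_nonneg_right hgap (Nat.cast_nonneg _)).trans (hdeg v)
  obtain ⟨P, hdisj, hind, hcov⟩ := hG.exists_isIndepSet_of_isCompleteBetween hcrit hχ hk rfl hq
    (by nlinarith) htq (by exact_mod_cast ht1) hdeg hS hSc
  refine hG.colorable_of_disjoint_of_isIndepSet hcrit hχ (by omega) rfl hq (μ := μ) (by linarith)
    hμ0 hμk.le ?_ hdeg hdisj (fun i => ?_) hind
  · have h1 : (N' : ℝ) ≤ Fintype.card V := by exact_mod_cast (le_max_right _ _).trans hV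
    have := hN'.trans h1
    rwa [div_le_iff₀' (by positivity)] at this
  · have := le_card_of_isIndepSet rfl hk hε0.le hdeg hind hcov i
    rwa [show 8 * k * ε + k * ε = μ by rw [hμε]; ring] at this

/-! ### Removing vertices of small degree -/

section Pruning

variable {V : Type*}

open scoped Classical in
/-- The number of ordered pairs of adjacent vertices in `U`, i.e. twice the number of edges
inside `U`. -/
noncomputable def dartCount (G : SimpleGraph V) (U : Finset V) : ℕ :=
  ∑ u ∈ U, #{x ∈ U | G.Adj u x}

open scoped Classical in
theorem dartCount_erase_add (G : SimpleGraph V) {U : Finset V} {v : V} (hv : v ∈ U) :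
    G.dartCount (U.erase v) + 2 * #{x ∈ U | G.Adj v x} = G.dartCount U := by
  have h : ∀ u, #{x ∈ U | G.Adj u x} = #{x ∈ U.erase v | G.Adj u x} +
      if G.Adj u v then 1 else 0 := by
    intro u
    simp only [card_filter]
    rw [← sum_erase_add _ _ hv]
  have h' : #{x ∈ U | G.Adj v x} = #{x ∈ U.erase v | G.Adj x v} := by
    rw [h v]
    simp [G.adj_comm]
  rw [dartCount, dartCount, ← sum_erase_add _ _ hv]
  simp only [h, sum_add_distrib]
  rw [← card_filter, ← h', h v]
  simp
  ring

theorem dartCount_univ [Fintype V] (G : SimpleGraph V) : G.dartCount univ = 2 * G.edgeSet.ncard := by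
  classical
  rw [← coe_edgeFinset, Set.ncard_coe_finset, ← sum_degrees_eq_twice_card_edges, dartCount]
  refine sum_congr rfl fun v _ => ?_
  rw [← card_neighborFinset_eq_degree, neighborFinset_eq_filter]

theorem dartCount_le_sq (G : SimpleGraph V) (U : Finset V) : G.dartCount U ≤ #U ^ 2 := by
  classical
  rw [dartCount, sq, ← smul_eq_mul]
  exact sum_le_card_nsmul _ _ _ fun u _ => card_filter_le _ _

/-- Passing to a vertex set `U` loses at most `n` edges per vertex removed. -/
theorem dartCount_univ_le [Fintype V] (G : SimpleGraph V) (U : Finset V) :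
    G.dartCount univ ≤ G.dartCount U + 2 * ((Fintype.card V - #U) * Fintype.card V) := by
  classical
  have h1 : G.dartCount univ ≤ G.dartCount U + 2 * ∑ u ∈ Uᶜ, #{x | G.Adj u x} := by
    have h2 : ∀ u, #{x | G.Adj u x} = #{x ∈ U | G.Adj u x} + #{x ∈ Uᶜ | G.Adj u x} := fun u => by
      rw [← card_union_of_disjoint (disjoint_filter_filter disjoint_compl_right), ← filter_union,
        union_compl]
    have h3 : ∑ u ∈ U, #{x ∈ Uᶜ | G.Adj u x} = ∑ u ∈ Uᶜ, #{x ∈ U | G.Adj u x} := by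
      simp only [card_filter]
      rw [sum_comm]
      simp only [G.adj_comm]
    have h4 : ∑ u ∈ Uᶜ, #{x ∈ U | G.Adj u x} ≤ ∑ u ∈ Uᶜ, #{x | G.Adj u x} :=
      sum_le_sum fun u _ => card_le_card (filter_subset_filter _ (subset_univ _))
    have h5 : ∑ u ∈ U, #{x | G.Adj u x} =
        ∑ u ∈ U, #{x ∈ U | G.Adj u x} + ∑ u ∈ U, #{x ∈ Uᶜ | G.Adj u x} := by
      rw [← sum_add_distrib]
      exact sum_congr rfl fun u _ => h2 u
    rw [dartCount, dartCount, ← sum_add_sum_compl U]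
    omega
  refine h1.trans ?_
  gcongr
  rw [← card_compl, ← smul_eq_mul]
  exact sum_le_card_nsmul _ _ _ fun u _ => card_le_univ _

open scoped Classical in
/-- A set `U` maximizing `2 e(G[U]) - α (m ^ 2 + m)`, where `m = |U|`, induces a graph of minimum
degree at least `α m`. -/
theorem exists_forall_mul_card_le_degree [Fintype V] (G : SimpleGraph V) (α : ℝ) :
    ∃ U : Finset V, (∀ v ∈ U, α * #U ≤ (#{x ∈ U | G.Adj v x} : ℝ)) ∧
      (G.dartCount univ : ℝ) - α * ((Fintype.card V : ℝ) ^ 2 + Fintype.card V) ≤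
        G.dartCount U - α * ((#U : ℝ) ^ 2 + #U) := by
  obtain ⟨U, -, hU⟩ := exists_max_image (univ : Finset (Finset V))
    (fun U => (G.dartCount U : ℝ) - α * ((#U : ℝ) ^ 2 + #U)) univ_nonempty
  refine ⟨U, fun v hv => ?_, by simpa using hU univ (mem_univ _)⟩
  have h1 := hU (U.erase v) (mem_univ _)
  have h2 := G.dartCount_erase_add hv
  have h2' : (G.dartCount (U.erase v) : ℝ) + 2 * #{x ∈ U | G.Adj v x} = G.dartCount U := by
    exact_mod_cast h2
  have h3 : (#(U.erase v) : ℝ) = #U - 1 := by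
    rw [card_erase_of_mem hv, Nat.cast_sub (card_pos.2 ⟨v, hv⟩), Nat.cast_one]
  simp only [h3] at h1
  nlinarith

end Pruning

/-! ### Class sizes of nearly extremal partitions -/

section Partition

variable {V : Type*} {k : ℕ}

open scoped Classical in
/-- Counting the ordered pairs of vertices in `Z` by whether their colours differ or agree. -/
theorem sum_card_ne_add_sum_sq (c : V → Fin k) (Z : Finset V) :
    ∑ u ∈ Z, #{x ∈ Z | c u ≠ c x} + ∑ i, #{v ∈ Z | c v = i} ^ 2 = #Z ^ 2 := by
  have h2 : ∑ i, #{v ∈ Z | c v = i} ^ 2 = ∑ u ∈ Z, #{x ∈ Z | c u = c x} := by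
    rw [← sum_fiberwise (s := Z) (g := c)]
    refine sum_congr rfl fun i _ => ?_
    rw [sq, ← smul_eq_mul, ← sum_const]
    refine sum_congr rfl fun u hu => ?_
    rw [← (mem_filter.1 hu).2]
    simp only [eq_comm]
  rw [h2, add_comm, ← sum_add_distrib]
  simp only [ne_eq, card_filter_add_card_filter_not, sum_const, smul_eq_mul, sq]

open scoped Classical in
/-- A `k`-partite graph has at most as many edges as the complete `k`-partite graph with the same
classes. -/
theorem dartCount_le_of_coloring {G : SimpleGraph V} {U Z : Finset V} (hUZ : U ⊆ Z)
    {c : V → Fin k} (hc : ∀ u ∈ U, ∀ v ∈ U, G.Adj u v → c u ≠ c v) :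
    G.dartCount U + ∑ i, #{v ∈ Z | c v = i} ^ 2 ≤ #Z ^ 2 := by
  rw [← sum_card_ne_add_sum_sq c Z]
  gcongr
  refine le_trans (sum_le_sum fun u hu => card_le_card fun x hx => ?_)
    (sum_le_sum_of_subset hUZ)
  rw [mem_filter] at hx ⊢
  exact ⟨hUZ hx.1, hc u hu x hx.1 hx.2⟩

open scoped Classical in
/-- The sum of the squared deviations of the class sizes of a partition into `k` classes from
their mean. -/
theorem sum_sq_sub_div (c : V → Fin k) (hk : 0 < k) (Z : Finset V) :
    ∑ i, ((#{v ∈ Z | c v = i} : ℝ) - #Z / k) ^ 2 =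
      ∑ i, (#{v ∈ Z | c v = i} : ℝ) ^ 2 - (#Z : ℝ) ^ 2 / k := by
  have h1 : ∑ i, (#{v ∈ Z | c v = i} : ℝ) = #Z := by
    rw [card_eq_sum_card_fiberwise (f := c) (s := Z) (t := univ) (fun _ _ => by simp)]
    push_cast
    rfl
  have hk0 : (k : ℝ) ≠ 0 := by positivity
  simp only [sub_sq, sum_add_distrib, sum_sub_distrib, ← sum_mul, ← mul_sum, h1]
  simp
  field_simp
  ring

open scoped Classical in
/-- Two colourings can be aligned by a permutation of the vertices, up to as many disagreements as
the difference of the class sizes forces. -/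
theorem exists_perm_card_ne_le [Fintype V] (c d : V → Fin k) :
    ∃ σ : Equiv.Perm V, (#{v | d (σ v) ≠ c v} : ℝ) ≤
      ∑ i, |(#{v | c v = i} : ℝ) - #{v | d v = i}| := by
  obtain ⟨σ, -, hσ⟩ := exists_max_image (univ : Finset (Equiv.Perm V))
    (fun σ => #{v | d (σ v) = c v}) univ_nonempty
  refine ⟨σ, ?_⟩
  have hfib : (#{v | d (σ v) ≠ c v} : ℝ) = ∑ i, (#{v | d (σ v) ≠ i ∧ c v = i} : ℝ) := by
    rw [card_eq_sum_card_fiberwise (f := c) (t := univ) (fun _ _ => by simp)]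
    push_cast
    refine sum_congr rfl fun i _ => ?_
    congr 2
    ext v
    simp only [mem_filter, mem_univ, true_and]
    constructor <;> rintro ⟨h, rfl⟩ <;> exact ⟨h, rfl⟩
  rw [hfib]
  refine sum_le_sum fun i _ => ?_
  rcases ({v | d (σ v) ≠ i ∧ c v = i} : Finset V).eq_empty_or_nonempty with h | ⟨v, hv⟩
  · rw [h, card_empty, Nat.cast_zero]; positivity
  simp only [mem_filter, mem_univ, true_and] at hv
  -- by maximality of the agreement, a swap cannot correct the vertex `v`
  have hsub : ∀ w, d (σ w) = i → c w = i := by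
    intro w hw
    by_contra hcw
    have hvw : v ≠ w := fun h => hcw (h ▸ hv.2)
    have h1 := hσ (σ * Equiv.swap v w) (mem_univ _)
    refine h1.not_gt (card_lt_card (ssubset_iff_of_subset (fun x hx => ?_) |>.2
      ⟨v, ?_, ?_⟩))
    · simp only [mem_filter, mem_univ, true_and] at hx ⊢
      have hxv : x ≠ v := by rintro rfl; exact hv.1 (hx.trans hv.2)
      have hxw : x ≠ w := by rintro rfl; exact hcw (hx.symm.trans hw)
      rw [Equiv.Perm.mul_apply, Equiv.swap_apply_of_ne_of_ne hxv hxw, hx]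
    · rw [mem_filter]
      exact ⟨mem_univ _, by rw [Equiv.Perm.mul_apply, Equiv.swap_apply_left, hw, hv.2]⟩
    · simp [hv.2, hv.1]
  have h1 : #{v | d (σ v) ≠ i ∧ c v = i} + #{v | d (σ v) = i} = #{v | c v = i} := by
    rw [← card_filter_add_card_filter_not (s := {v | c v = i}) (fun v => d (σ v) = i),
      filter_filter, filter_filter, add_comm]
    congr 2
    · ext w
      simp only [mem_filter, mem_univ, true_and]
      exact ⟨fun h => ⟨hsub w h, h⟩, fun h => h.2⟩
    · ext w
      simp [and_comm]
  have h2 : #{v | d (σ v) = i} = #{v | d v = i} :=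
    card_equiv σ fun x => by simp
  rw [h2] at h1
  have h3 : (#{v | d (σ v) ≠ i ∧ c v = i} : ℝ) + #{v | d v = i} = #{v | c v = i} := by
    exact_mod_cast h1
  rw [← h3, add_sub_cancel_right]
  exact le_abs_self _

end Partition

/-! ### The Turán graph -/

section Turan

/-- The colouring of the vertices of `turanGraph n k` by their residues modulo `k`. -/
def turanColor {k : ℕ} (hk : 0 < k) (n : ℕ) (v : Fin n) : Fin k := ⟨v % k, Nat.mod_lt _ hk⟩

theorem turanGraph_adj_iff_turanColor_ne {k n : ℕ} (hk : 0 < k) {u v : Fin n} :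
    (turanGraph n k).Adj u v ↔ turanColor hk n u ≠ turanColor hk n v := by
  simp [turanGraph_adj, turanColor]

open scoped Classical in
theorem abs_card_turanColor_eq_sub_le {k : ℕ} (hk : 0 < k) (n : ℕ) (i : Fin k) :
    |(#{v | turanColor hk n v = i} : ℝ) - n / k| ≤ 1 := by
  have h1 : #{v | turanColor hk n v = i} = n.count (· ≡ i [MOD k]) := by
    rw [Nat.count_eq_card_filter_range, card_filter, card_filter,
      ← Fin.sum_univ_eq_sum_range (fun v => if v ≡ i [MOD k] then 1 else 0)]
    refine sum_congr rfl fun v _ => ?_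
    simp [turanColor, Fin.ext_iff, Nat.ModEq, Nat.mod_eq_of_lt i.2]
  rw [h1, Nat.count_modEq_card _ hk]
  have hk0 : (0 : ℝ) < k := by exact_mod_cast hk
  have h2 : ((n / k : ℕ) : ℝ) ≤ n / k := Nat.cast_div_le
  have h3 : (n : ℝ) / k < (n / k : ℕ) + 1 := by
    rw [div_lt_iff₀ hk0]
    exact_mod_cast Nat.lt_mul_of_div_lt (Nat.lt_succ_self _) hk
  rw [abs_le]
  push_cast
  split_ifs <;> constructor <;> linarith

open scoped Classical in
theorem le_two_mul_turanNumber {k : ℕ} (hk : 0 < k) (n : ℕ) :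
    (1 - 1 / k) * (n : ℝ) ^ 2 - k ≤ 2 * turanNumber k n := by
  have h1 : (turanGraph n k).dartCount univ + ∑ i, #{v | turanColor hk n v = i} ^ 2 = n ^ 2 := by
    have := sum_card_ne_add_sum_sq (turanColor hk n) univ
    rw [card_univ, Fintype.card_fin] at this
    rw [← this, dartCount]
    simp only [turanGraph_adj_iff_turanColor_ne hk]
  rw [dartCount_univ] at h1
  have h2 : (2 * turanNumber k n : ℝ) + ∑ i, (#{v | turanColor hk n v = i} : ℝ) ^ 2 = n ^ 2 := by
    exact_mod_cast h1
  have h3 := sum_sq_sub_div (turanColor hk n) hk univ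
  have h4 : ∑ i, ((#{v | turanColor hk n v = i} : ℝ) - n / k) ^ 2 ≤ ∑ _i : Fin k, (1 : ℝ) :=
    sum_le_sum fun i _ => by
      rw [sq_le_one_iff_abs_le_one]
      exact abs_card_turanColor_eq_sub_le hk n i
  rw [sum_const, card_univ, Fintype.card_fin, nsmul_eq_mul, mul_one] at h4
  rw [card_univ, Fintype.card_fin] at h3
  rw [h3] at h4
  have : (1 - 1 / k) * (n : ℝ) ^ 2 = n ^ 2 - n ^ 2 / k := by ring
  linarith

end Turan

/-! ### Nearly extremal graphs without `H` -/

section Stability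

open scoped Classical in
/-- If every member of a set `E` of edges has an endpoint in `B`, then `|E| ≤ |B| n`. -/
theorem ncard_le_card_mul_of_exists_mem {V : Type*} [Fintype V] {E : Set (Sym2 V)} {B : Finset V}
    (h : ∀ u v, s(u, v) ∈ E → u ∈ B ∨ v ∈ B) : E.ncard ≤ #B * Fintype.card V := by
  have hsub : E ⊆ ((B ×ˢ (univ : Finset V)).image fun p => s(p.1, p.2) : Finset (Sym2 V)) := by
    intro e he
    induction e with
    | _ u v =>
    rw [mem_coe, mem_image]
    rcases h u v he with hu | hv
    · exact ⟨(u, v), by simp [hu], rfl⟩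
    · exact ⟨(v, u), by simp [hv], Sym2.eq_swap⟩
  calc E.ncard ≤ #((B ×ˢ (univ : Finset V)).image fun p => s(p.1, p.2)) := by
        rw [← Set.ncard_coe_finset]
        exact Set.ncard_le_ncard hsub (finite_toSet _)
    _ ≤ #(B ×ˢ (univ : Finset V)) := card_image_le
    _ = #B * Fintype.card V := by rw [card_product, card_univ]

/-- If `G` has at most `r` edges fewer than `T`, then the size of the symmetric difference is
controlled by the number of edges of `G` that are not in `T`. -/
theorem ncard_symmDiff_edgeSet_le {V : Type*} [Finite V] {G T : SimpleGraph V} {r : ℝ}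
    (h : (T.edgeSet.ncard : ℝ) - r ≤ G.edgeSet.ncard) :
    ((symmDiff G.edgeSet T.edgeSet).ncard : ℝ) ≤ r + 2 * (G.edgeSet \ T.edgeSet).ncard := by
  have h1 : (symmDiff G.edgeSet T.edgeSet).ncard ≤
      (G.edgeSet \ T.edgeSet).ncard + (T.edgeSet \ G.edgeSet).ncard := Set.ncard_union_le _ _
  have h2 := Set.ncard_inter_add_ncard_sdiff_eq_ncard G.edgeSet T.edgeSet
  have h3 := Set.ncard_inter_add_ncard_sdiff_eq_ncard T.edgeSet G.edgeSet
  rw [Set.inter_comm] at h3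
  have h1' : ((symmDiff G.edgeSet T.edgeSet).ncard : ℝ) ≤
      (G.edgeSet \ T.edgeSet).ncard + (T.edgeSet \ G.edgeSet).ncard := by exact_mod_cast h1
  rw [← h2, ← h3] at h
  push_cast at h
  linarith

/-- A `k`-colourable graph with at least as many edges as the Turán graph is a Turán graph. -/
theorem Colorable.isTuranUpTo_zero {n k : ℕ} {G : SimpleGraph (Fin n)} (hG : G.Colorable k)
    (hk : 0 < k) (h : turanNumber k n ≤ G.edgeSet.ncard) : G.IsTuranUpTo k 0 := by
  classical
  have hmax : G.IsTuranMaximal k := by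
    refine ⟨hG.cliqueFree (Nat.lt_succ_self k), fun G' _ hG' => ?_⟩
    have h1 := (isTuranMaximal_turanGraph (n := n) hk).2 hG'
    rw [turanNumber, ← coe_edgeFinset, ← coe_edgeFinset, Set.ncard_coe_finset,
      Set.ncard_coe_finset] at h
    refine le_trans ?_ (h1.trans ?_)
    · exact le_of_eq (by congr)
    · exact le_trans (le_of_eq (by congr)) h
  refine ⟨G, ?_, by simp⟩
  have h2 := hmax.nonempty_iso_turanGraph
  rwa [Fintype.card_fin] at h2

open scoped Classical in
/-- A graph on `n` vertices, most of whose vertices are properly coloured by `c` with nearly equal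
class sizes, is close to the Turán graph. -/
theorem isTuranUpTo_of_coloring {n k : ℕ} (hk : 0 < k) {G : SimpleGraph (Fin n)}
    {U : Finset (Fin n)} {c : Fin n → Fin k} (hc : ∀ u ∈ U, ∀ v ∈ U, G.Adj u v → c u ≠ c v)
    {r D : ℝ} (hD : ∑ i, ((#{v | c v = i} : ℝ) - n / k) ^ 2 ≤ D)
    (hr : (turanNumber k n : ℝ) - r ≤ G.edgeSet.ncard) :
    G.IsTuranUpTo k (r + 2 * ((n - #U + k * (√D + 1)) * n)) := by
  obtain ⟨σ, hσ⟩ := exists_perm_card_ne_le c (turanColor hk n)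
  have hwrong : (#{v | turanColor hk n (σ v) ≠ c v} : ℝ) ≤ k * (√D + 1) := by
    refine hσ.trans ((sum_le_sum (g := fun _ => √D + 1) fun i _ => ?_).trans_eq (by simp [mul_add]))
    have h1 : |(#{v | c v = i} : ℝ) - n / k| ≤ √D := by
      refine Real.abs_le_sqrt (le_trans ?_ hD)
      exact single_le_sum (f := fun i => ((#{v | c v = i} : ℝ) - n / k) ^ 2)
        (fun _ _ => sq_nonneg _) (mem_univ i)
    have h2 := abs_card_turanColor_eq_sub_le hk n i
    rw [abs_le] at h1 h2 ⊢
    constructor <;> linarith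
  set B : Finset (Fin n) := {v | turanColor hk n (σ v) ≠ c v} with hBdef
  let T := (turanGraph n k).comap σ
  let e : T ≃g turanGraph n k := Iso.comap σ _
  have hT : T.edgeSet.ncard = turanNumber k n := by
    rw [turanNumber, ← Nat.card_coe_set_eq, ← Nat.card_coe_set_eq]
    exact Nat.card_congr e.mapEdgeSet
  refine ⟨T, ⟨e⟩, (ncard_symmDiff_edgeSet_le (by rw [hT]; exact hr)).trans ?_⟩
  have hB := ncard_le_card_mul_of_exists_mem (E := G.edgeSet \ T.edgeSet)
    (B := Uᶜ ∪ B) (fun u v huv => by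
      by_contra! h
      simp only [hBdef, ne_eq, mem_union, mem_compl, mem_filter, mem_univ, true_and, not_or, not_not] at h
      obtain ⟨⟨hu, hcu⟩, hv, hcv⟩ := h
      refine huv.2 ?_
      rw [mem_edgeSet, comap_adj, turanGraph_adj_iff_turanColor_ne hk, hcu, hcv]
      exact hc u hu v hv huv.1)
  have hBcard : (#(Uᶜ ∪ B) : ℝ) ≤ n - #U + k * (√D + 1) := by
    have h1 := card_union_le Uᶜ B
    have h2 := card_add_card_compl U
    rw [Fintype.card_fin] at h2
    have h1' : (#(Uᶜ ∪ B) : ℝ) ≤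
      #Uᶜ + #B := by exact_mod_cast h1
    have h2' : (#U : ℝ) + #Uᶜ = n := by exact_mod_cast h2
    linarith
  rw [Fintype.card_fin] at hB
  have hB' : ((G.edgeSet \ T.edgeSet).ncard : ℝ) ≤ (n - #U + k * (√D + 1)) * n := by
    refine (Nat.cast_le.2 hB).trans ?_
    rw [Nat.cast_mul]
    gcongr
  linarith

open scoped Classical in
/-- A graph without `H` on `n` vertices with nearly `t_k(n)` edges is `k`-colourable after removing
few vertices, namely `O(r / n)` of them if `r` edges are missing. -/
theorem exists_coloring_of_turanNumber_sub_le {W : Type*} [Fintype W] {H : SimpleGraph W} {k : ℕ}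
    (hk : 2 ≤ k) (hcrit : H.HasCriticalEdge) (hχ : H.chromaticNumber = ((k + 1 : ℕ) : ℕ∞)) :
    ∃ ε : ℝ, 0 < ε ∧ ε ≤ 1 / 4 ∧ ∃ N : ℕ, ∀ n ≥ N, ∀ r : ℝ, 0 ≤ r →
      r ≤ ε / 8 * (n : ℝ) ^ 2 → ∀ G : SimpleGraph (Fin n), H.Free G → (turanNumber k n : ℝ) - r ≤ G.edgeSet.ncard →
      ∃ (U : Finset (Fin n)) (c : Fin n → Fin k),
        (∀ u ∈ U, ∀ v ∈ U, G.Adj u v → c u ≠ c v) ∧ ε * ((n - #U) * n) ≤ 4 * r ∧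
          2 < ε * n := by
  obtain ⟨ε, hε, hε4, N, hN⟩ := exists_colorable_of_le_degree hk hcrit hχ
  have hk0 : 0 < k := by omega
  have hk2 : (2 : ℝ) ≤ k := by exact_mod_cast hk
  have hkinv : (1 : ℝ) / k ≤ 1 / 2 := one_div_le_one_div_of_le (by norm_num) hk2
  have hkinv0 : (0 : ℝ) < 1 / k := by positivity
  obtain ⟨M, hM⟩ := exists_nat_ge (4 * (1 + k) / ε + 2 * N / ε)
  refine ⟨ε, hε, hε4, M, fun n hn r hr0 hr G hG he => ?_⟩
  have hn1 : 4 * (1 + k) / ε + 2 * N / ε ≤ (n : ℝ) := hM.trans (by exact_mod_cast hn)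
  rw [← add_div, div_le_iff₀' hε] at hn1
  have hN0 : (0 : ℝ) ≤ N := Nat.cast_nonneg _
  have hn0 : (0 : ℝ) ≤ n := Nat.cast_nonneg _
  have hn1' : (1 : ℝ) ≤ n := by nlinarith
  set α : ℝ := 1 - 1 / k - ε with hα
  have hα0 : 0 ≤ α := by linarith
  have hα1 : α ≤ 1 := by linarith
  obtain ⟨U, hUdeg, hU⟩ := G.exists_forall_mul_card_le_degree α
  have hmn : (#U : ℝ) ≤ n := by
    have := card_le_univ U
    rw [Fintype.card_fin] at this
    exact_mod_cast this
  have hm0 : (0 : ℝ) ≤ #U := Nat.cast_nonneg _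
  have hdart : (1 - 1 / k) * (n : ℝ) ^ 2 - k - 2 * r ≤ G.dartCount univ := by
    rw [dartCount_univ]
    push_cast
    linarith [le_two_mul_turanNumber hk0 n]
  rw [Fintype.card_fin] at hU
  have hlow : ε * (n : ℝ) ^ 2 - n - k - 2 * r + α * ((#U : ℝ) ^ 2 + #U) ≤ G.dartCount U := by
    have : α * n ≤ 1 * n := by gcongr
    have : (1 - 1 / k) * (n : ℝ) ^ 2 = (α + ε) * n ^ 2 := by rw [hα]; ring
    nlinarith
  -- the quadratic gain in the number of edges forces `U` to be large
  have hNU : N ≤ #U := by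
    have h1 : (G.dartCount U : ℝ) ≤ (#U : ℝ) ^ 2 := by exact_mod_cast G.dartCount_le_sq U
    have h2 : 0 ≤ α * ((#U : ℝ) ^ 2 + #U) := by positivity
    have h3 : n + k ≤ ε / 4 * (n : ℝ) ^ 2 := by nlinarith
    have h4 : ε / 2 * (n : ℝ) ^ 2 ≤ (#U : ℝ) ^ 2 := by linarith
    have h5 : (N : ℝ) ^ 2 ≤ ε / 2 * (n : ℝ) ^ 2 := by
      have h6 : 2 * N ≤ ε * n := by linarith
      have h7 : (2 * (N : ℝ)) ^ 2 ≤ (ε * n) ^ 2 := by gcongr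
      nlinarith [mul_nonneg hε.le (sq_nonneg (n : ℝ))]
    have := abs_le_of_sq_le_sq (h5.trans h4) hm0
    rw [abs_of_nonneg hN0] at this
    exact_mod_cast this
  have hcol : (G.induce {x | x ∈ U}).Colorable k := by
    have hcard : Fintype.card {x // x ∈ U} = #U := Fintype.card_coe U
    refine hN (V := {x // x ∈ U}) _ (by rwa [hcard])
      (fun h => hG (h.trans ⟨Copy.induce G _⟩)) fun v => ?_
    rw [hcard]
    refine (hUdeg v v.2).trans (le_of_eq ?_)
    congr 1
    rw [← card_map (Function.Embedding.subtype fun x => x ∈ U)]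
    congr 1
    ext x
    simp [and_comm]
  obtain ⟨C⟩ := hcol
  let c : Fin n → Fin k := fun v => if h : v ∈ U then C ⟨v, h⟩ else ⟨0, hk0⟩
  have hc : ∀ u ∈ U, ∀ v ∈ U, G.Adj u v → c u ≠ c v := fun u hu v hv huv => by
    simp only [c, hu, hv, dif_pos]
    exact C.valid huv
  refine ⟨U, c, hc, ?_, by linarith⟩
  have hup : (G.dartCount U : ℝ) ≤ (1 - 1 / k) * (#U : ℝ) ^ 2 := by
    have h1 := dartCount_le_of_coloring Subset.rfl hc
    have h2 := sum_sq_sub_div c hk0 U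
    have h3 : 0 ≤ ∑ i, ((#{v ∈ U | c v = i} : ℝ) - #U / k) ^ 2 :=
      sum_nonneg fun _ _ => sq_nonneg _
    have h1' : (G.dartCount U : ℝ) + ∑ i, (#{v ∈ U | c v = i} : ℝ) ^ 2 ≤ (#U : ℝ) ^ 2 := by
      exact_mod_cast h1
    have : (1 - 1 / k) * (#U : ℝ) ^ 2 = (#U : ℝ) ^ 2 - (#U : ℝ) ^ 2 / k := by ring
    linarith
  have hcast : (#U : ℝ) = n ∨ (1 : ℝ) ≤ n - #U := by
    have h1 : #U ≤ n := by exact_mod_cast hmn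
    rcases h1.eq_or_lt with h | h
    · exact Or.inl (by rw [h])
    · have h2 : (#U : ℝ) + 1 ≤ n := by exact_mod_cast h
      exact Or.inr (by linarith)
  rcases hcast with h | h
  · rw [h, sub_self]; linarith
  set s : ℝ := n - #U with hs
  have hm : (#U : ℝ) = n - s := by rw [hs]; ring
  have hαε : (1 - 1 / k : ℝ) = α + ε := by rw [hα]; ring
  rw [hαε] at hdart hup
  have h1 : ε * (n ^ 2 - (#U : ℝ) ^ 2) ≤ k + 2 * r + α * s := by
    rw [hs]; nlinarith
  have h2 : s * n ≤ (n : ℝ) ^ 2 - (#U : ℝ) ^ 2 := by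
    have : (n : ℝ) ^ 2 - (#U : ℝ) ^ 2 = s * n + s * #U := by rw [hs]; ring
    rw [this]
    linarith [mul_nonneg (zero_le_one.trans h) hm0]
  have h3 : ε * (s * n) ≤ ε * (n ^ 2 - (#U : ℝ) ^ 2) := by gcongr
  have h4 : (k : ℝ) * 1 ≤ k * s := by gcongr
  have h5 : α * s ≤ 1 * s := by gcongr
  have h6 : 4 * (1 + k) * s ≤ ε * n * s := by
    refine mul_le_mul_of_nonneg_right ?_ (zero_le_one.trans h)
    linarith
  linarith

/-- The quantitative form of the stability theorem: a graph without `H` that has at most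
`r ≤ δ n ^ 2` edges fewer than the Turán graph is `O(√r n)`-close to it. -/
theorem exists_isTuranUpTo_sqrt_mul {W : Type*} [Fintype W] {H : SimpleGraph W} {k : ℕ}
    (hk : 2 ≤ k) (hcrit : H.HasCriticalEdge) (hχ : H.chromaticNumber = ((k + 1 : ℕ) : ℕ∞)) :
    ∃ C δ : ℝ, 0 < δ ∧ ∃ N : ℕ, ∀ n ≥ N, ∀ r : ℝ, 0 ≤ r → r ≤ δ * (n : ℝ) ^ 2 →
      ∀ G : SimpleGraph (Fin n), H.Free G → (turanNumber k n : ℝ) - r ≤ G.edgeSet.ncard →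
      G.IsTuranUpTo k (C * (√r * n)) := by
  classical
  obtain ⟨ε, hε, hε4, N, hN⟩ := exists_coloring_of_turanNumber_sub_le hk hcrit hχ
  have hk0 : 0 < k := by omega
  have hk1 : (1 : ℝ) ≤ k := by exact_mod_cast hk0
  set D : ℝ := 2 * k + 2 + 8 / ε with hD
  have hD0 : 0 ≤ D := by positivity
  set C : ℝ := 1 + 8 / ε + 2 * (k * (√D + 2)) with hC
  have hC0 : 0 ≤ C := by positivity
  refine ⟨C, ε / 8, by positivity, N, fun n hn r hr0 hr G hG he => ?_⟩
  obtain ⟨U, c, hc, hU, hεn⟩ := hN n hn r hr0 hr G hG he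
  have hn0 : (0 : ℝ) ≤ n := Nat.cast_nonneg _
  have hUcard : #U + #Uᶜ = n := by rw [card_add_card_compl, Fintype.card_fin]
  have hUcard' : (n : ℝ) - #U = #Uᶜ := by
    have : (#U : ℝ) + #Uᶜ = n := by exact_mod_cast hUcard
    linarith
  rcases lt_or_ge r (1 / 2) with hr2 | hr2
  · -- no vertex is removed, so `G` is `k`-colourable with at least `t_k(n)` edges
    have hUuniv : U = univ := by
      rw [← compl_eq_empty_iff, ← card_eq_zero]
      by_contra hne
      have h1 : (1 : ℝ) ≤ #Uᶜ := by exact_mod_cast Nat.one_le_iff_ne_zero.2 hne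
      rw [hUcard'] at hU
      nlinarith
    have hcol : G.Colorable k :=
      ⟨Coloring.mk c fun {u v} huv => hc u (by simp [hUuniv]) v (by simp [hUuniv]) huv⟩
    have he' : turanNumber k n ≤ G.edgeSet.ncard := by
      have : (turanNumber k n : ℝ) < (G.edgeSet.ncard + 1 : ℕ) := by push_cast; linarith
      exact Nat.lt_succ_iff.1 (by exact_mod_cast this)
    obtain ⟨T, hT, hT'⟩ := hcol.isTuranUpTo_zero hk0 he'
    exact ⟨T, hT, hT'.trans (by positivity)⟩
  · have hvar : ∑ i, ((#{v | c v = i} : ℝ) - n / k) ^ 2 ≤ D * r := by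
      have h1 := dartCount_le_of_coloring (subset_univ U) hc
      have h2 := sum_sq_sub_div c hk0 univ
      have h3 := G.dartCount_univ_le U
      have h4 := le_two_mul_turanNumber hk0 n
      rw [dartCount_univ] at h3
      rw [card_univ, Fintype.card_fin] at h1 h2
      rw [Fintype.card_fin, (by omega : n - #U = #Uᶜ)] at h3
      have h1' : (G.dartCount U : ℝ) + ∑ i, (#{v | c v = i} : ℝ) ^ 2 ≤ (n : ℝ) ^ 2 := by
        exact_mod_cast h1
      have h3' : 2 * (G.edgeSet.ncard : ℝ) ≤ G.dartCount U + 2 * (#Uᶜ * n) := by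
        exact_mod_cast h3
      have h5 : (#Uᶜ : ℝ) * n ≤ 4 / ε * r := by
        rw [← hUcard', div_mul_eq_mul_div, le_div_iff₀' hε]
        exact hU
      have h6 : (1 - 1 / k) * (n : ℝ) ^ 2 = n ^ 2 - n ^ 2 / k := by ring
      have h7 : (k : ℝ) ≤ 2 * k * r := by nlinarith
      have h8 : D * r = 2 * k * r + 2 * r + 2 * (4 / ε * r) := by rw [hD]; ring
      rw [h2, h8]
      linarith
    obtain ⟨T, hT, hT'⟩ := isTuranUpTo_of_coloring hk0 hc hvar he
    refine ⟨T, hT, hT'.trans ?_⟩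
    have hsr : √r * √r = r := Real.mul_self_sqrt hr0
    have hs0 : 0 ≤ √r := Real.sqrt_nonneg r
    have h1 : 1 ≤ 2 * √r := by nlinarith
    have h2 : √r ≤ n := by
      rw [Real.sqrt_le_left hn0]
      nlinarith [sq_nonneg (n : ℝ)]
    have h3 : r ≤ √r * n := by
      rw [← hsr]
      simpa [hsr] using mul_le_mul_of_nonneg_left h2 hs0
    have h4 : ((n : ℝ) - #U) * n ≤ 4 / ε * r := by
      rw [div_mul_eq_mul_div, le_div_iff₀' hε]
      exact hU
    have h5 : 4 / ε * r ≤ 4 / ε * (√r * n) := by gcongr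
    have h6 : k * (√(D * r) + 1) * n ≤ k * ((√D + 2) * √r) * n := by
      rw [Real.sqrt_mul hD0]
      gcongr
      linarith
    have h7 : C * (√r * n) = √r * n + 2 * (4 / ε * (√r * n)) + 2 * (k * ((√D + 2) * √r) * n) := by
      rw [hC]; ring
    rw [h7, add_mul]
    linarith

/-- Any two graphs on `n` vertices differ in at most `n ^ 2` edges. -/
theorem isTuranUpTo_sq {n : ℕ} (G : SimpleGraph (Fin n)) (k : ℕ) :
    G.IsTuranUpTo k ((n : ℝ) ^ 2) := by
  classical
  refine ⟨turanGraph n k, ⟨Iso.refl⟩, ?_⟩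
  have h := ncard_le_card_mul_of_exists_mem (E := symmDiff G.edgeSet (turanGraph n k).edgeSet)
    (B := univ) fun u _ _ => Or.inl (mem_univ u)
  rw [card_univ, Fintype.card_fin, ← sq] at h
  exact_mod_cast h

theorem IsTuranUpTo.mono {n k : ℕ} {G : SimpleGraph (Fin n)} {r s : ℝ} (h : G.IsTuranUpTo k r)
    (hrs : r ≤ s) : G.IsTuranUpTo k s := by
  obtain ⟨T, hT, hT'⟩ := h
  exact ⟨T, hT, hT'.trans hrs⟩

end Stability

end SimpleGraph

theorem mainTheorem2 {W : Type*} [Finite W] (H : SimpleGraph W) (k : ℕ) (hk : 2 ≤ k)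
    (hcrit : H.HasCriticalEdge) (hχ : H.chromaticNumber = ((k + 1 : ℕ) : ℕ∞)) :
    ∃ C : ℝ, ∀ f : ℕ → ℝ, (∀ n, 0 ≤ f n) →
      f =o[atTop] (fun n : ℕ => (n : ℝ) ^ 2) →
      (∃ n₀ : ℕ, ∀ n ≥ n₀, ∀ G : SimpleGraph (Fin n), H.Free G →
        (SimpleGraph.turanNumber k n : ℝ) - f n ≤ (G.edgeSet.ncard : ℝ) →
        G.IsTuranUpTo k (C * (f n ^ (1 / 2 : ℝ) * n))) ∧
      (∃ C' : ℝ, ∀ n : ℕ, 0 < f n → ∀ G : SimpleGraph (Fin n), H.Free G →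
        (SimpleGraph.turanNumber k n : ℝ) - f n ≤ (G.edgeSet.ncard : ℝ) →
        G.IsTuranUpTo k (C' * (f n ^ (1 / 2 : ℝ) * n))) := by
  have := Fintype.ofFinite W
  obtain ⟨C, δ, hδ, N, hN⟩ := SimpleGraph.exists_isTuranUpTo_sqrt_mul hk hcrit hχ
  refine ⟨C, fun f hf hfo => ?_⟩
  simp only [← Real.sqrt_eq_rpow]
  obtain ⟨M, hM⟩ := eventually_atTop.1 (hfo.def hδ)
  have hlarge : ∀ n ≥ max N M, ∀ G : SimpleGraph (Fin n), H.Free G →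
      (SimpleGraph.turanNumber k n : ℝ) - f n ≤ (G.edgeSet.ncard : ℝ) →
      G.IsTuranUpTo k (C * (√(f n) * n)) := fun n hn => by
    refine hN n ((le_max_left _ _).trans hn) (f n) (hf n) ?_
    simpa [abs_of_nonneg (hf n)] using hM n ((le_max_right _ _).trans hn)
  refine ⟨⟨max N M, hlarge⟩, ?_⟩
  -- for the finitely many small `n`, the trivial bound `n ^ 2` is absorbed into the constant
  let g : ℕ → ℝ := fun n => n / √(f n)
  have hg : ∀ n, 0 ≤ g n := fun n => by positivity
  refine ⟨|C| + ∑ n ∈ Finset.range (max N M), g n, fun n hn G hG he => ?_⟩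
  have hsum : 0 ≤ ∑ n ∈ Finset.range (max N M), g n := Finset.sum_nonneg fun n _ => hg n
  rcases le_or_gt (max N M) n with h | h
  · refine (hlarge n h G hG he).mono ?_
    gcongr
    linarith [le_abs_self C]
  · refine (G.isTuranUpTo_sq k).mono ?_
    have h1 : g n ≤ |C| + ∑ n ∈ Finset.range (max N M), g n :=
      (Finset.single_le_sum (fun n _ => hg n) (Finset.mem_range.2 h)).trans
        (le_add_of_nonneg_left (abs_nonneg C))
    have hs : 0 < √(f n) := Real.sqrt_pos.2 hn
    calc (n : ℝ) ^ 2 = g n * (√(f n) * n) := by simp only [g]; field_simp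
      _ ≤ _ := by gcongr
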